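/- Throughout, graphs are finite and simple, and an $n$-cube is a closed $n$-dimensional hypercube of side length $1$. Visibility is defined as follows. A graph $G$ is an \emph{$n$-cube visibility graph} if its vertices can be assigned to pairwise disjoint axis-aligned $n$-cubes in $\mathbb{R}^n$, one cube for each vertex, such that two distinct vertices are adjacent if and only if there is an axis-parallel cylindrical channel of positive diameter that leads from the cube of one to the cube of the other and whose interior meets no cube of the assignment. It is an \emph{$n$-cube orthogonal visibility graph} if its vertices can be assigned to pairwise disjoint $n$-cubes in $\mathbb{R}^{n+1}$ that are aligned with the first $n$ axes (so each lies in a hyperplane orthogonal to $\mathbf{e}_{n+1}$), one cube for each vertex, such that two distinct vertices are adjacent if and only if there is such an uninterrupted channel parallel to $\mathbf{e}_{n+1}$ between their cubes. (In $\mathbb{R}^1$ a channel is simply an interval; a $0$-cube is a point.) An \emph{$n$-cube (orthogonal) visibility tree} is a tree that is an $n$-cube (orthogonal) visibility graph, and an \emph{$n$-cube (orthogonal) visibility forest} is a disjoint union of $n$-cube (orthogonal) visibility trees. The \emph{$n$-cube arboricity} $\Upsilon_{h^{(n)}}(G)$ of a graph $G$ is the minimum $k$ such that $G$ is the union of $k$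 subgraphs that are $n$-cube visibility forests, and the \emph{$n$-cube orthogonal arboricity} $\Upsilon_{h^{(n)\perp}}(G)$ is the minimum $k$ such that $G$ is the union of $k$ subgraphs that are $n$-cube orthogonal visibility forests. \textbf{Theorem.} Let $n\ge 1$ and let $T$ be a finite tree. Then the minima that define $\Upsilon_{h^{(n)}}(T)$ and $\Upsilon_{h^{(n-1)\perp}}(T)$ exist, and $$\Upsilon_{h^{(n)}}(T)=\left\lceil \frac{\Upsilon_{h^{(n-1)\perp}}(T)}{n}\right\rceil .$$ -/

import Mathlib

/-- The closed axis-aligned unit `n`-cube in `ℝⁿ` with lowest corner `p`. -/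
def unitCube {n : ℕ} (p : Fin n → ℝ) : Set (Fin n → ℝ) :=
  {x | ∀ i, p i ≤ x i ∧ x i ≤ p i + 1}

/-- The closed unit `n`-cube in `ℝⁿ⁺¹`, aligned with the first `n` axes and orthogonal to the
last one, with lowest corner `p`; its height is the last coordinate of `p`. -/
def flatCube {n : ℕ} (p : Fin (n + 1) → ℝ) : Set (Fin (n + 1) → ℝ) :=
  {x | (∀ i : Fin n, p i.castSucc ≤ x i.castSucc ∧ x i.castSucc ≤ p i.castSucc + 1) ∧
    x (Fin.last n) = p (Fin.last n)}

/-- The open round cylinder of radius `r` around the line through `c` in the direction of the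
`i`-th axis. (In `ℝ¹` this is the whole line, for every `r > 0`.) -/
def axisCylinder {m : ℕ} (i : Fin m) (c : Fin m → ℝ) (r : ℝ) : Set (Fin m → ℝ) :=
  {x | ∑ k ∈ Finset.univ.erase i, (x k - c k) ^ 2 < r ^ 2}

/-- For a family of sets `B` in `ℝᵐ`: there is an uninterrupted cylindrical channel of positive
diameter, parallel to the `i`-th axis, that leads from `B a` upwards (that is, in the positive
direction of the axis) to `B b`. The two end discs of the channel lie in `B a` and in `B b`, and no
set of the family meets the channel between them. -/
def HasChannel {V : Type*} {m : ℕ} (B : V → Set (Fin m → ℝ)) (i : Fin m) (a b : V) : Prop :=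
  ∃ (c : Fin m → ℝ) (r s t : ℝ), 0 < r ∧ s < t ∧
    (∀ x ∈ axisCylinder i c r, x i = s → x ∈ B a) ∧
    (∀ x ∈ axisCylinder i c r, x i = t → x ∈ B b) ∧
    ∀ w, ∀ x ∈ axisCylinder i c r, s < x i → x i < t → x ∉ B w

/-- `B a` and `B b` see each other in the direction of the `i`-th axis. -/
def SeesAlong {V : Type*} {m : ℕ} (B : V → Set (Fin m → ℝ)) (i : Fin m) (a b : V) : Prop :=
  HasChannel B i a b ∨ HasChannel B i b a

/-- `G` is an `n`-cube visibility graph. -/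
def IsCubeVisGraph {V : Type*} (n : ℕ) (G : SimpleGraph V) : Prop :=
  ∃ p : V → Fin n → ℝ,
    (∀ u v, u ≠ v → Disjoint (unitCube (p u)) (unitCube (p v))) ∧
    ∀ u v, u ≠ v → (G.Adj u v ↔ ∃ i : Fin n, SeesAlong (fun w => unitCube (p w)) i u v)

/-- `G` is an `n`-cube orthogonal visibility graph. -/
def IsCubeOrthVisGraph {V : Type*} (n : ℕ) (G : SimpleGraph V) : Prop :=
  ∃ p : V → Fin (n + 1) → ℝ,
    (∀ u v, u ≠ v → Disjoint (flatCube (p u)) (flatCube (p v))) ∧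
    ∀ u v, u ≠ v → (G.Adj u v ↔ SeesAlong (fun w => flatCube (p w)) (Fin.last n) u v)

/-- An `n`-cube visibility tree. -/
def IsCubeVisTree {V : Type*} (n : ℕ) (G : SimpleGraph V) : Prop :=
  G.IsTree ∧ IsCubeVisGraph n G

/-- An `n`-cube orthogonal visibility tree. -/
def IsCubeOrthVisTree {V : Type*} (n : ℕ) (G : SimpleGraph V) : Prop :=
  G.IsTree ∧ IsCubeOrthVisGraph n G

/-- An `n`-cube visibility forest: a disjoint union of `n`-cube visibility trees. -/
def IsCubeVisForest {V : Type*} (n : ℕ) (G : SimpleGraph V) : Prop :=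
  ∀ C : G.ConnectedComponent, IsCubeVisTree n C.toSimpleGraph

/-- An `n`-cube orthogonal visibility forest: a disjoint union of `n`-cube orthogonal visibility
trees. -/
def IsCubeOrthVisForest {V : Type*} (n : ℕ) (G : SimpleGraph V) : Prop :=
  ∀ C : G.ConnectedComponent, IsCubeOrthVisTree n C.toSimpleGraph

/-- `G` is the union of `k` subgraphs (as to vertices and edges) that are `n`-cube visibility
forests. -/
def IsUnionOfCubeVisForests {V : Type*} (n : ℕ) (G : SimpleGraph V) (k : ℕ) : Prop :=
  ∃ F : Fin k → G.Subgraph, (∀ j, IsCubeVisForest n (F j).coe) ∧ ⨆ j, F j = ⊤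

/-- `G` is the union of `k` subgraphs (as to vertices and edges) that are `n`-cube orthogonal
visibility forests. -/
def IsUnionOfCubeOrthVisForests {V : Type*} (n : ℕ) (G : SimpleGraph V) (k : ℕ) : Prop :=
  ∃ F : Fin k → G.Subgraph, (∀ j, IsCubeOrthVisForest n (F j).coe) ∧ ⨆ j, F j = ⊤

/-- The `n`-cube arboricity of `G`. -/
noncomputable def cubeArboricity {V : Type*} (n : ℕ) (G : SimpleGraph V) : ℕ :=
  sInf {k | IsUnionOfCubeVisForests n G k}

/-- The `n`-cube orthogonal arboricity of `G`. -/
noncomputable def cubeOrthArboricity {V : Type*} (n : ℕ) (G : SimpleGraph V) : ℕ :=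
  sInf {k | IsUnionOfCubeOrthVisForests n G k}

/-! Write `n = m + 1`. Two constructions give the formula: a cube forest splits into `n` orthogonal
forests, one per axis, and `n` orthogonal forests in a tree, one per axis, merge into one cube
forest. Regrouping optimal decompositions in both directions gives the ceiling.

Splitting (`CubeForest.exists_orthForests`): flatten the cubes along axis `i` and keep the edges
seen along `i`. Passing to a component deletes cubes, which might open new views. Acyclicity forbids
this (`SeesUp.of_isAcyclic`): the cubes met by a generic line lie in order on a path of `T`, and a
path between two vertices of a component never leaves it, so every blocker is still present.

Merging (`cubeForest_iSup`): make the forests `E i` edge-disjoint. Each component `s` of each `E i`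
has a representation, and every vertex of the tree has a gate in `s`, the vertex of `s` where it is
attached. The position of a vertex is the sum over all `s` of the position of its gate in `s`,
heights being scaled by large factors (`exists_scale`). Inside `s` all other gates are constant, so
the picture of `s` survives up to translation and scaling of heights. Vertices of one component of
the union that lie in different components of `E i` have different gates in some component for
another axis, hence are more than `1` apart in that coordinate and are irrelevant to each other
along `i`. -/

/-! ### Visibility through a single point of the projection -/

/-- For unit cubes (or flat unit cubes) with lowest corners `p`, indexed by the vertices in `W`:
the cube of `b` is visible from that of `a` when looking upwards along the `i`-th axis. -/
def SeesUp {V : Type*} {m : ℕ} (W : Set V) (p : V → Fin m → ℝ) (i : Fin m) (a b : V) : Prop :=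
  p a i < p b i ∧ ∃ x : Fin m → ℝ,
    (∀ k, k ≠ i → p a k < x k ∧ x k < p a k + 1) ∧
    (∀ k, k ≠ i → p b k < x k ∧ x k < p b k + 1) ∧
    ∀ w ∈ W, p a i < p w i → p w i < p b i → ¬ ∀ k, k ≠ i → p w k ≤ x k ∧ x k ≤ p w k + 1

theorem SeesUp.mono {V : Type*} {m : ℕ} {W W' : Set V} {p : V → Fin m → ℝ} {i : Fin m} {a b : V}
    (h : SeesUp W p i a b) (hW : W' ⊆ W) : SeesUp W' p i a b := by
  obtain ⟨h1, x, ha, hb, hw⟩ := h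
  exact ⟨h1, x, ha, hb, fun w hw' => hw w (hW hw')⟩

theorem seesUp_range {U V : Type*} {m : ℕ} (f : U → V) (p : V → Fin m → ℝ) (i : Fin m) (a b : U) :
    SeesUp (Set.range f) p i (f a) (f b) ↔ SeesUp Set.univ (fun u => p (f u)) i a b := by
  simp [SeesUp]

/-- The axes are interchangeable, so an orthogonal representation can be turned to face any of them.
-/
theorem seesUp_comp_equiv {V : Type*} {m : ℕ} (W : Set V) (p : V → Fin m → ℝ)
    (σ : Equiv.Perm (Fin m)) (i : Fin m) (a b : V) :
    SeesUp W (fun v k => p v (σ k)) i a b ↔ SeesUp W p (σ i) a b := by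
  have key : ∀ P : Fin m → Prop, (∀ k, k ≠ σ i → P k) ↔ ∀ k, k ≠ i → P (σ k) := by
    intro P
    rw [← σ.forall_congr_right]
    simp
  unfold SeesUp
  refine and_congr_right fun _ => ?_
  simp only [key]
  constructor
  · rintro ⟨x, h1, h2, h3⟩
    exact ⟨fun k => x (σ.symm k), by simpa using h1, by simpa using h2, by simpa using h3⟩
  · rintro ⟨x, h1, h2, h3⟩
    exact ⟨fun k => x (σ k), h1, h2, h3⟩

/-- Both ends give strict inequalities and the finitely many obstacles are closed. Openness is what
allows a generic point and a whole cylinder of points. -/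
theorem isOpen_setOf_seesUp_points {V : Type*} [Finite V] {m : ℕ} (W : Set V)
    (p : V → Fin m → ℝ) (i : Fin m) (a b : V) :
    IsOpen {x : Fin m → ℝ | (∀ k, k ≠ i → p a k < x k ∧ x k < p a k + 1) ∧
      (∀ k, k ≠ i → p b k < x k ∧ x k < p b k + 1) ∧
      ∀ w ∈ W, p a i < p w i → p w i < p b i →
        ¬ ∀ k, k ≠ i → p w k ≤ x k ∧ x k ≤ p w k + 1} := by
  have h1 : ∀ v : V, IsOpen {x : Fin m → ℝ | ∀ k, k ≠ i → p v k < x k ∧ x k < p v k + 1} := by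
    intro v
    simp only [Set.ofPred_forall]
    refine isOpen_iInter_of_finite fun k => isOpen_iInter_of_finite fun _ => ?_
    exact (isOpen_lt continuous_const (continuous_apply k)).inter
      (isOpen_lt (continuous_apply k) continuous_const)
  have h2 : ∀ v : V, IsClosed {x : Fin m → ℝ | ∀ k, k ≠ i → p v k ≤ x k ∧ x k ≤ p v k + 1} := by
    intro v
    simp only [Set.ofPred_forall]
    refine isClosed_iInter fun k => isClosed_iInter fun _ => ?_
    exact (isClosed_le continuous_const (continuous_apply k)).inter
      (isClosed_le (continuous_apply k) continuous_const)
  refine (h1 a).inter ((h1 b).inter ?_)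
  change IsOpen {x : Fin m → ℝ | ∀ w ∈ W, p a i < p w i → p w i < p b i →
        ¬ ∀ k, k ≠ i → p w k ≤ x k ∧ x k ≤ p w k + 1}
  simp only [Set.ofPred_forall]
  exact isOpen_iInter_of_finite fun w => isOpen_iInter_of_finite fun _ =>
    isOpen_iInter_of_finite fun _ => isOpen_iInter_of_finite fun _ => (h2 w).isOpen_compl

/-- The point through which `b` is visible from `a` may be chosen off the boundaries of all
projections. -/
theorem SeesUp.exists_generic {V : Type*} [Finite V] {m : ℕ} {W : Set V} {p : V → Fin m → ℝ}
    {i : Fin m} {a b : V} (h : SeesUp W p i a b) :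
    ∃ x : Fin m → ℝ, (∀ v k, x k ≠ p v k ∧ x k ≠ p v k + 1) ∧
    (∀ k, k ≠ i → p a k < x k ∧ x k < p a k + 1) ∧
    (∀ k, k ≠ i → p b k < x k ∧ x k < p b k + 1) ∧
    ∀ w ∈ W, p a i < p w i → p w i < p b i →
      ¬ ∀ k, k ≠ i → p w k ≤ x k ∧ x k ≤ p w k + 1 := by
  obtain ⟨-, x, hx⟩ := h
  have hd : Dense (Set.univ.pi fun k : Fin m =>
      ((Set.range fun v => p v k) ∪ Set.range fun v => p v k + 1)ᶜ) :=
    dense_pi _ fun k _ => Set.Countable.dense_compl ℝ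
      ((Set.finite_range _).union (Set.finite_range _)).countable
  obtain ⟨y, hy, hy'⟩ := hd.exists_mem_open (isOpen_setOf_seesUp_points W p i a b) ⟨x, hx⟩
  refine ⟨y, fun v k => ?_, hy'⟩
  have := hy k (Set.mem_univ k)
  simp only [Set.mem_compl_iff, Set.mem_union, Set.mem_range, not_or, not_exists] at this
  exact ⟨fun e => this.1 v e.symm, fun e => this.2 v e.symm⟩

theorem abs_sub_lt_of_mem_axisCylinder {m : ℕ} {i : Fin m} {c y : Fin m → ℝ} {r : ℝ} (hr : 0 < r)
    (hy : y ∈ axisCylinder i c r) {k : Fin m} (hk : k ≠ i) : |y k - c k| < r := by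
  refine abs_lt_of_sq_lt_sq (lt_of_le_of_lt ?_ hy) hr.le
  exact Finset.single_le_sum (f := fun k => (y k - c k) ^ 2) (fun _ _ => sq_nonneg _)
    (Finset.mem_erase.2 ⟨hk, Finset.mem_univ k⟩)

theorem update_mem_axisCylinder {m : ℕ} {i : Fin m} {c y : Fin m → ℝ} {r : ℝ} (t : ℝ) :
    Function.update y i t ∈ axisCylinder i c r ↔ y ∈ axisCylinder i c r := by
  unfold axisCylinder
  simp only [Set.mem_ofPred_eq]
  rw [Finset.sum_congr rfl fun k hk => ?_]
  rw [Function.update_of_ne (Finset.ne_of_mem_erase hk)]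

theorem self_mem_axisCylinder {m : ℕ} (i : Fin m) (c : Fin m → ℝ) {r : ℝ} (hr : 0 < r) :
    c ∈ axisCylinder i c r := by
  simp [axisCylinder, hr]

theorem update_add_mem_axisCylinder {m : ℕ} (i : Fin m) (c : Fin m → ℝ) (k : Fin m) {d r : ℝ}
    (hd : |d| < r) : Function.update c k (c k + d) ∈ axisCylinder i c r := by
  unfold axisCylinder
  simp only [Set.mem_ofPred_eq]
  refine lt_of_le_of_lt (Finset.sum_le_univ_sum_of_nonneg fun _ => sq_nonneg _) ?_
  rw [Finset.sum_eq_single k]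
  · simpa using sq_lt_sq' (by linarith [neg_abs_le d]) (lt_of_abs_lt hd)
  · intro j _ hj
    simp [Function.update_of_ne hj]
  · simp

/-- Around a point through which `b` is visible from `a` there is a whole cylinder of such
points. -/
theorem SeesUp.exists_cylinder {V : Type*} [Finite V] {m : ℕ} {W : Set V} {p : V → Fin m → ℝ}
    {i : Fin m} {a b : V} (h : SeesUp W p i a b) :
    ∃ (c : Fin m → ℝ) (r : ℝ), 0 < r ∧ ∀ y ∈ axisCylinder i c r,
    (∀ k, k ≠ i → p a k < y k ∧ y k < p a k + 1) ∧
    (∀ k, k ≠ i → p b k < y k ∧ y k < p b k + 1) ∧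
    ∀ w ∈ W, p a i < p w i → p w i < p b i →
      ¬ ∀ k, k ≠ i → p w k ≤ y k ∧ y k ≤ p w k + 1 := by
  obtain ⟨-, x, hx⟩ := h
  obtain ⟨r, hr, hball⟩ := Metric.isOpen_iff.1 (isOpen_setOf_seesUp_points W p i a b) x hx
  refine ⟨x, r, hr, fun y hy => ?_⟩
  -- The cylinder leaves coordinate `i` free and the conditions ignore it, so it can be reset to
  -- land in the sup-metric ball.
  have hmem : Function.update y i (x i) ∈ Metric.ball x r := by
    rw [Metric.mem_ball, dist_pi_lt_iff hr]
    intro k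
    by_cases hk : k = i
    · subst hk; simpa using hr
    · rw [Function.update_of_ne hk, Real.dist_eq]
      exact abs_sub_lt_of_mem_axisCylinder hr hy hk
  have key : ∀ q : ℝ → Fin m → Prop,
      (∀ k, k ≠ i → q (Function.update y i (x i) k) k) ↔ ∀ k, k ≠ i → q (y k) k := by
    intro q
    refine forall_congr' fun k => forall_congr' fun hk => ?_
    rw [Function.update_of_ne hk]
  obtain ⟨h1, h2, h3⟩ := hball hmem
  refine ⟨(key fun t k => p a k < t ∧ t < p a k + 1).1 h1,
    (key fun t k => p b k < t ∧ t < p b k + 1).1 h2, fun w hw ha hb hc => h3 w hw ha hb ?_⟩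
  exact (key fun t k => p w k ≤ t ∧ t ≤ p w k + 1).2 hc

/-- A disc orthogonal to the `i`-th axis that lies between two values in each other coordinate has
its centre strictly between them. -/
theorem strict_of_disc {m : ℕ} {i : Fin m} {c : Fin m → ℝ} {r s : ℝ} (hr : 0 < r)
    {q : Fin m → ℝ}
    (h : ∀ x ∈ axisCylinder i c r, x i = s → ∀ k, k ≠ i → q k ≤ x k ∧ x k ≤ q k + 1) :
    ∀ k, k ≠ i → q k < c k ∧ c k < q k + 1 := by
  intro k hk
  have main : ∀ d, |d| < r → q k ≤ c k + d ∧ c k + d ≤ q k + 1 := by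
    intro d hd
    have := h (Function.update (Function.update c k (c k + d)) i s)
      ((update_mem_axisCylinder s).2 (update_add_mem_axisCylinder i c k hd)) (by simp) k hk
    simpa [Function.update_of_ne hk] using this
  -- Weak bounds at `c k ± r / 2` become strict at `c k`.
  have h1 := main (r / 2) (by rw [abs_of_pos (by linarith)]; linarith)
  have h2 := main (-(r / 2)) (by rw [abs_neg, abs_of_pos (by linarith)]; linarith)
  constructor <;> linarith

theorem mem_flatCube {n : ℕ} {p x : Fin (n + 1) → ℝ} :
    x ∈ flatCube p ↔ (∀ k, k ≠ Fin.last n → p k ≤ x k ∧ x k ≤ p k + 1) ∧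
      x (Fin.last n) = p (Fin.last n) := by
  unfold flatCube
  simp only [Set.mem_ofPred_eq, and_congr_left_iff]
  intro _
  constructor
  · intro h k hk
    obtain ⟨j, rfl⟩ := Fin.exists_castSucc_eq.2 hk
    exact h j
  · intro h j
    exact h _ (Fin.castSucc_lt_last j).ne

theorem hasChannel_flatCube_iff {V : Type*} [Finite V] {n : ℕ} (p : V → Fin (n + 1) → ℝ)
    (a b : V) : HasChannel (fun w => flatCube (p w)) (Fin.last n) a b ↔
      SeesUp Set.univ p (Fin.last n) a b := by
  constructor
  · rintro ⟨c, r, s, t, hr, hst, ha, hb, hw⟩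
    have hc := fun u : ℝ => (update_mem_axisCylinder u).2 (self_mem_axisCylinder (Fin.last n) c hr)
    have hs : s = p a (Fin.last n) := by
      simpa using (mem_flatCube.1 (ha _ (hc s) (by simp))).2
    have ht : t = p b (Fin.last n) := by
      simpa using (mem_flatCube.1 (hb _ (hc t) (by simp))).2
    refine ⟨by rwa [← hs, ← ht], c, strict_of_disc hr fun x hx hxs => (mem_flatCube.1 (ha x hx hxs)).1,
      strict_of_disc hr fun x hx hxs => (mem_flatCube.1 (hb x hx hxs)).1, fun w _ h1 h2 h3 => ?_⟩
    refine hw w _ (hc (p w (Fin.last n))) (by simpa [hs]) (by simpa [ht]) (mem_flatCube.2 ⟨?_, by simp⟩)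
    intro k hk
    simpa [Function.update_of_ne hk] using h3 k hk
  · intro h
    obtain ⟨c, r, hr, hy⟩ := h.exists_cylinder
    refine ⟨c, r, p a (Fin.last n), p b (Fin.last n), hr, h.1, ?_, ?_, ?_⟩
    · exact fun x hx hs => mem_flatCube.2 ⟨fun k hk => ⟨((hy x hx).1 k hk).1.le,
        ((hy x hx).1 k hk).2.le⟩, hs⟩
    · exact fun x hx hs => mem_flatCube.2 ⟨fun k hk => ⟨((hy x hx).2.1 k hk).1.le,
        ((hy x hx).2.1 k hk).2.le⟩, hs⟩
    · intro w x hx h1 h2 h3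
      obtain ⟨h4, h5⟩ := mem_flatCube.1 h3
      exact (hy x hx).2.2 w (Set.mem_univ w) (h5 ▸ h1) (h5 ▸ h2) h4

theorem disjoint_unitCube_iff {n : ℕ} {p q : Fin n → ℝ} :
    Disjoint (unitCube p) (unitCube q) ↔ ∃ k, 1 < |p k - q k| := by
  rw [Set.disjoint_left]
  constructor
  · intro h
    by_contra! hc
    refine h (a := fun k => max (p k) (q k)) ?_ ?_ <;> intro k <;>
      have := abs_le.1 (hc k) <;> simp only [le_max_left, le_max_right, true_and, max_le_iff] <;>
      constructor <;> linarith
  · rintro ⟨k, hk⟩ x hp hq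
    have h1 := hp k
    have h2 := hq k
    rcases lt_abs.1 hk with h | h <;> linarith

theorem disjoint_flatCube_iff {n : ℕ} {p q : Fin (n + 1) → ℝ} :
    Disjoint (flatCube p) (flatCube q) ↔
      (p (Fin.last n) = q (Fin.last n) → ∃ k, k ≠ Fin.last n ∧ 1 < |p k - q k|) := by
  rw [Set.disjoint_left]
  constructor
  · intro h heq
    by_contra! hc
    refine h (a := fun k => max (p k) (q k)) (mem_flatCube.2 ⟨?_, by simp [heq]⟩)
      (mem_flatCube.2 ⟨?_, by simp [heq]⟩) <;> intro k hk <;>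
      have := abs_le.1 (hc k hk) <;>
      simp only [le_max_left, le_max_right, true_and, max_le_iff] <;>
      constructor <;> linarith
  · intro h x hp hq
    rw [mem_flatCube] at hp hq
    obtain ⟨k, hk, h'⟩ := h (hp.2.symm.trans hq.2)
    have h1 := hp.1 k hk
    have h2 := hq.1 k hk
    rcases lt_abs.1 h' with h | h <;> linarith

/-- Disjoint cubes with overlapping projections are more than `1` apart in height, so comparing
lowest corners leaves room for a channel from the top of `a` to the bottom of `b`. -/
theorem hasChannel_unitCube_iff {V : Type*} [Finite V] {m : ℕ} (p : V → Fin m → ℝ)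
    (i : Fin m) (a b : V)
    (hd : ∀ u v, u ≠ v → Disjoint (unitCube (p u)) (unitCube (p v))) :
    HasChannel (fun w => unitCube (p w)) i a b ↔ SeesUp Set.univ p i a b := by
  have far : ∀ (x : Fin m → ℝ) (u v : V), p u i < p v i →
      (∀ k, k ≠ i → p u k ≤ x k ∧ x k ≤ p u k + 1) →
      (∀ k, k ≠ i → p v k ≤ x k ∧ x k ≤ p v k + 1) → p u i + 1 < p v i := by
    intro x u v huv hu hv
    have hne : u ≠ v := by rintro rfl; exact lt_irrefl _ huv
    obtain ⟨k, hk⟩ := disjoint_unitCube_iff.1 (hd u v hne)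
    by_cases hki : k = i
    · subst hki
      rw [abs_of_neg (by linarith)] at hk
      linarith
    · have h1 := hu k hki
      have h2 := hv k hki
      rcases lt_abs.1 hk with h | h <;> linarith
  constructor
  · rintro ⟨c, r, s, t, hr, hst, ha, hb, hw⟩
    have hc := fun u : ℝ => (update_mem_axisCylinder u).2 (self_mem_axisCylinder i c hr)
    have hac : ∀ k, k ≠ i → p a k < c k ∧ c k < p a k + 1 :=
      strict_of_disc hr fun x hx hxs k _ => ha x hx hxs k
    have hbc : ∀ k, k ≠ i → p b k < c k ∧ c k < p b k + 1 :=
      strict_of_disc hr fun x hx hxs k _ => hb x hx hxs k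
    have hs : p a i ≤ s ∧ s ≤ p a i + 1 := by simpa using ha _ (hc s) (by simp) i
    have ht : p b i ≤ t ∧ t ≤ p b i + 1 := by simpa using hb _ (hc t) (by simp) i
    have free : ∀ w, (∀ k, k ≠ i → p w k ≤ c k ∧ c k ≤ p w k + 1) → p w i < t →
        s < p w i + 1 → False := by
      intro w hwc h1 h2
      obtain ⟨u, hu1, hu2⟩ := exists_between
        (show max (p w i) s < min (p w i + 1) t by simp [h1, h2, hst])
      simp only [max_lt_iff, lt_min_iff] at hu1 hu2
      refine hw w _ (hc u) (by simpa using hu1.2) (by simpa using hu2.2) fun k => ?_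
      by_cases hk : k = i
      · subst hk; simpa using ⟨hu1.1.le, hu2.1.le⟩
      · simpa [Function.update_of_ne hk] using hwc k hk
    -- The cubes of `a` and `b` themselves must not enter the channel, which pins down its two ends.
    have hsa : s = p a i + 1 := by
      by_contra hne
      exact free a (fun k hk => ⟨(hac k hk).1.le, (hac k hk).2.le⟩) (by linarith)
        (lt_of_le_of_ne hs.2 hne)
    have htb : t = p b i := by
      by_contra hne
      exact free b (fun k hk => ⟨(hbc k hk).1.le, (hbc k hk).2.le⟩)
        (lt_of_le_of_ne ht.1 (Ne.symm hne)) (by linarith)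
    exact ⟨by linarith, c, hac, hbc, fun w _ h1 h2 h3 => free w h3 (by linarith) (by linarith)⟩
  · intro h
    obtain ⟨c, r, hr, hy⟩ := h.exists_cylinder
    have hya := fun x hx k hk => (hy x hx).1 k hk
    have hyb := fun x hx k hk => (hy x hx).2.1 k hk
    have hc := self_mem_axisCylinder i c hr
    refine ⟨c, r, p a i + 1, p b i, hr, far c a b h.1
      (fun k hk => ⟨(hya c hc k hk).1.le, (hya c hc k hk).2.le⟩)
      (fun k hk => ⟨(hyb c hc k hk).1.le, (hyb c hc k hk).2.le⟩), ?_, ?_, ?_⟩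
    · intro x hx hs k
      by_cases hk : k = i
      · subst hk; constructor <;> linarith
      · exact ⟨(hya x hx k hk).1.le, (hya x hx k hk).2.le⟩
    · intro x hx hs k
      by_cases hk : k = i
      · subst hk; constructor <;> linarith
      · exact ⟨(hyb x hx k hk).1.le, (hyb x hx k hk).2.le⟩
    · intro w x hx h1 h2 h3
      have h4 := h3 i
      exact (hy x hx).2.2 w (Set.mem_univ w) (by linarith) (by linarith) fun k _ => h3 k

/-! ### Subgraphs of acyclic graphs -/

/-- Paths in `T` are unique, so a path inside `G` with the same ends must be `q`. -/
theorem SimpleGraph.IsAcyclic.exists_mapLe_eq {V : Type*} {T G : SimpleGraph V} (hT : T.IsAcyclic)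
    (hG : G ≤ T) {a b : V} (h : G.Reachable a b) (q : T.Walk a b) (hq : q.IsPath) :
    ∃ q' : G.Walk a b, q'.mapLe hG = q := by
  classical
  obtain ⟨w⟩ := h
  refine ⟨w.toPath, ?_⟩
  exact congrArg Subtype.val ((hT.subsingleton_path a b).elim
    ⟨w.toPath.1.mapLe hG, SimpleGraph.Walk.isPath_mapLe hG |>.2 w.toPath.2⟩ ⟨q, hq⟩)

theorem SimpleGraph.IsAcyclic.adj_of_reachable {V : Type*} {T G : SimpleGraph V}
    (hT : T.IsAcyclic) (hG : G ≤ T) {a b : V} (h : G.Reachable a b) (hab : T.Adj a b) :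
    G.Adj a b := by
  obtain ⟨q, hq⟩ := hT.exists_mapLe_eq hG h (.cons hab .nil) (by simp [hab.ne])
  have : s(a, b) ∈ q.edges := by
    rw [← SimpleGraph.Walk.edges_mapLe_eq_edges hG, hq]; simp
  exact q.adj_of_mem_edges this

theorem SimpleGraph.IsAcyclic.reachable_of_mem_support {V : Type*} {T G : SimpleGraph V}
    (hT : T.IsAcyclic) (hG : G ≤ T) {a b : V} (h : G.Reachable a b) (q : T.Walk a b)
    (hq : q.IsPath) {v : V} (hv : v ∈ q.support) : G.Reachable a v := by
  classical
  obtain ⟨q', rfl⟩ := hT.exists_mapLe_eq hG h q hq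
  rw [SimpleGraph.Walk.support_mapLe_eq_support] at hv
  exact ⟨q'.takeUntil v hv⟩

/-- Vertices of a finite set on which a height function is injective, such that any two
consecutive ones are adjacent, lie on a path that passes them in order of height. -/
theorem SimpleGraph.exists_isPath_of_consecutive {V : Type*} [Finite V] (T : SimpleGraph V)
    (S : Set V) (h : V → ℝ) (hinj : Set.InjOn h S)
    (hS : ∀ a ∈ S, ∀ b ∈ S, h a < h b → (∀ w ∈ S, h a < h w → h w < h b → False) → T.Adj a b)
    {b : V} (hb : b ∈ S) : ∀ a ∈ S, h a < h b →
      ∃ q : T.Walk a b, q.IsPath ∧ (∀ w ∈ q.support, h a ≤ h w) ∧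
        ∀ w ∈ S, h a < h w → h w < h b → w ∈ q.support := by
  suffices H : ∀ (n : ℕ) (a : V), {w ∈ S | h a < h w}.ncard = n → a ∈ S → h a < h b →
      ∃ q : T.Walk a b, q.IsPath ∧ (∀ w ∈ q.support, h a ≤ h w) ∧
        ∀ w ∈ S, h a < h w → h w < h b → w ∈ q.support from fun a => H _ a rfl
  intro n
  induction n using Nat.strong_induction_on with
  | _ n ih =>
    intro a hn ha hab
    rcases Set.eq_empty_or_nonempty {w ∈ S | h a < h w ∧ h w < h b} with he | hne
    · have hno : ∀ w ∈ S, h a < h w → h w < h b → False := fun w hw h1 h2 =>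
        (Set.eq_empty_iff_forall_notMem.1 he w) ⟨hw, h1, h2⟩
      have hadj := hS a ha b hb hab hno
      exact ⟨.cons hadj .nil, by simp [hadj.ne], by simp [hab.le],
        fun w hw h1 h2 => (hno w hw h1 h2).elim⟩
    -- `c` is the next vertex of `S` above `a`. The path from `c` stays at or above its height, so
    -- prepending `a` repeats no vertex.
    · obtain ⟨c, ⟨hcS, hac, hcb⟩, hmin⟩ := Set.exists_min_image _ h (Set.toFinite _) hne
      have hadj : T.Adj a c := hS a ha c hcS hac fun w hw h1 h2 =>
        absurd (hmin w ⟨hw, h1, h2.trans hcb⟩) (not_le.2 h2)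
      have hlt : {w ∈ S | h c < h w}.ncard < n := by
        rw [← hn]
        refine Set.ncard_lt_ncard ⟨fun w hw => ⟨hw.1, hac.trans hw.2⟩, fun hsub => ?_⟩
          (Set.toFinite _)
        exact lt_irrefl _ (hsub ⟨hcS, hac⟩).2
      obtain ⟨q, hq, hge, hmem⟩ := ih _ hlt c rfl hcS hcb
      refine ⟨.cons hadj q, (SimpleGraph.Walk.cons_isPath_iff _ _).2
        ⟨hq, fun hmem => absurd (hge a hmem) (not_le.2 hac)⟩, ?_, ?_⟩
      · intro w hw
        rw [SimpleGraph.Walk.support_cons, List.mem_cons] at hw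
        rcases hw with rfl | hw
        · exact le_rfl
        · exact hac.le.trans (hge w hw)
      · intro w hw h1 h2
        rw [SimpleGraph.Walk.support_cons, List.mem_cons]
        right
        rcases (hmin w ⟨hw, h1, h2⟩).lt_or_eq with h3 | h3
        · exact hmem w hw h3 h2
        · rw [← hinj hcS hw h3]; exact q.start_mem_support

/-! ### Representable sets of vertices -/

/-- The flat cubes with corners `p`, orthogonal to the `i`-th axis, represent `T` on `W`. -/
structure IsOrthRep {V : Type*} {m : ℕ} (T : SimpleGraph V) (W : Set V) (i : Fin m)
    (p : V → Fin m → ℝ) : Prop where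
  disjoint : ∀ u ∈ W, ∀ v ∈ W, u ≠ v → p u i = p v i → ∃ k, k ≠ i ∧ 1 < |p u k - p v k|
  adj_iff : ∀ u ∈ W, ∀ v ∈ W, u ≠ v → (T.Adj u v ↔ SeesUp W p i u v ∨ SeesUp W p i v u)

/-- The unit cubes with corners `p` represent `T` on `W`. -/
structure IsCubeRep {V : Type*} {m : ℕ} (T : SimpleGraph V) (W : Set V)
    (p : V → Fin m → ℝ) : Prop where
  disjoint : ∀ u ∈ W, ∀ v ∈ W, u ≠ v → ∃ k, 1 < |p u k - p v k|
  adj_iff : ∀ u ∈ W, ∀ v ∈ W, u ≠ v →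
    (T.Adj u v ↔ ∃ i, SeesUp W p i u v ∨ SeesUp W p i v u)

/-- Every connected component of `G` induces in `T` an `m`-cube orthogonal visibility graph. -/
def OrthForest {V : Type*} (m : ℕ) (T G : SimpleGraph V) : Prop :=
  ∀ C : G.ConnectedComponent, ∃ p : V → Fin (m + 1) → ℝ, IsOrthRep T C.supp (Fin.last m) p

/-- Every connected component of `G` induces in `T` an `m`-cube visibility graph. -/
def CubeForest {V : Type*} (m : ℕ) (T G : SimpleGraph V) : Prop :=
  ∀ C : G.ConnectedComponent, ∃ p : V → Fin m → ℝ, IsCubeRep T C.supp p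

theorem IsOrthRep.comp_equiv {V : Type*} {m : ℕ} {T : SimpleGraph V} {W : Set V} {i j : Fin m}
    {p : V → Fin m → ℝ} (h : IsOrthRep T W i p) (σ : Equiv.Perm (Fin m)) (hσ : σ j = i) :
    IsOrthRep T W j fun v k => p v (σ k) := by
  subst hσ
  refine ⟨fun u hu v hv huv he => ?_, fun u hu v hv huv => ?_⟩
  · obtain ⟨k, hk, hk'⟩ := h.disjoint u hu v hv huv he
    refine ⟨σ.symm k, fun e => hk (by simp [← e]), by simpa using hk'⟩
  · rw [seesUp_comp_equiv, seesUp_comp_equiv]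
    exact h.adj_iff u hu v hv huv

theorem IsOrthRep.exists_axis {V : Type*} {m : ℕ} {T : SimpleGraph V} {W : Set V} {i : Fin m}
    {p : V → Fin m → ℝ} (h : IsOrthRep T W i p) (j : Fin m) :
    ∃ p : V → Fin m → ℝ, IsOrthRep T W j p :=
  ⟨_, h.comp_equiv (Equiv.swap j i) (Equiv.swap_apply_left j i)⟩

/-- Visibility within a connected subset of an acyclic graph is not created by deleting the
other cubes. -/
theorem SeesUp.of_isAcyclic {V : Type*} [Finite V] {m : ℕ} {T G : SimpleGraph V}
    (hT : T.IsAcyclic) (hG : G ≤ T) {W : Set V} {i : Fin m} {p : V → Fin m → ℝ}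
    (hd : ∀ u ∈ W, ∀ v ∈ W, u ≠ v → p u i = p v i → ∃ k, k ≠ i ∧ 1 < |p u k - p v k|)
    (hadj : ∀ u ∈ W, ∀ v ∈ W, SeesUp W p i u v → T.Adj u v)
    (C : G.ConnectedComponent) (hC : C.supp ⊆ W) {a b : V} (ha : a ∈ C.supp) (hb : b ∈ C.supp)
    (h : SeesUp C.supp p i a b) : SeesUp W p i a b := by
  obtain ⟨x, hgen, hxa, hxb, hfree⟩ := h.exists_generic
  -- The cubes met by the generic line. It meets them all in the interior of their projections, so
  -- disjointness makes their heights distinct and consecutive ones see each other.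
  set S : Set V := {w ∈ W | ∀ k, k ≠ i → p w k < x k ∧ x k < p w k + 1} with hSdef
  have hstrict : ∀ w, (∀ k, k ≠ i → p w k ≤ x k ∧ x k ≤ p w k + 1) →
      ∀ k, k ≠ i → p w k < x k ∧ x k < p w k + 1 := fun w hw k hk =>
    ⟨lt_of_le_of_ne (hw k hk).1 (hgen w k).1.symm, lt_of_le_of_ne (hw k hk).2 (hgen w k).2⟩
  have hinj : Set.InjOn (fun w => p w i) S := by
    intro u hu v hv huv
    by_contra hne
    obtain ⟨k, hk, hk'⟩ := hd u hu.1 v hv.1 hne huv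
    have h1 := hu.2 k hk
    have h2 := hv.2 k hk
    rcases lt_abs.1 hk' with h | h <;> linarith
  have hsees : ∀ u ∈ S, ∀ v ∈ S, p u i < p v i →
      (∀ w ∈ S, p u i < p w i → p w i < p v i → False) → SeesUp W p i u v :=
    fun u hu v hv huv hno => ⟨huv, x, hu.2, hv.2, fun w hw h1 h2 h3 =>
      hno w ⟨hw, hstrict w h3⟩ h1 h2⟩
  have haS : a ∈ S := ⟨hC ha, hxa⟩
  have hbS : b ∈ S := ⟨hC hb, hxb⟩
  refine hsees a haS b hbS h.1 fun w hw h1 h2 => ?_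
  obtain ⟨q, hq, -, hmem⟩ := T.exists_isPath_of_consecutive S (fun w => p w i) hinj
    (fun u hu v hv huv hno => hadj u hu.1 v hv.1 (hsees u hu v hv huv hno)) hbS a haS h.1
  -- A blocker `w` lies on the tree path from `a` to `b`, hence in `C`, where it would already
  -- block.
  have hr := hT.reachable_of_mem_support hG (C.reachable_of_mem_supp ha hb) q hq (hmem w hw h1 h2)
  have hwC : w ∈ C.supp := by
    rw [SimpleGraph.ConnectedComponent.mem_supp_iff] at ha ⊢
    rw [← ha, SimpleGraph.ConnectedComponent.eq]
    exact hr.symm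
  exact hfree w hwC h1 h2 fun k hk => ⟨(hw.2 k hk).1.le, (hw.2 k hk).2.le⟩

/-- A `T`-edge inside a component of `G` is a `G`-edge, hence seen; conversely, deleting the other
cubes creates no view. This serves both for subforests and for splitting by axes. -/
theorem isOrthRep_of_isAcyclic {V : Type*} [Finite V] {m : ℕ} {T G : SimpleGraph V}
    (hT : T.IsAcyclic) (hG : G ≤ T) {W : Set V} {i : Fin m} {p : V → Fin m → ℝ}
    (hd : ∀ u ∈ W, ∀ v ∈ W, u ≠ v → p u i = p v i → ∃ k, k ≠ i ∧ 1 < |p u k - p v k|)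
    (hadj : ∀ u ∈ W, ∀ v ∈ W, SeesUp W p i u v → T.Adj u v)
    (hsees : ∀ u ∈ W, ∀ v ∈ W, G.Adj u v → SeesUp W p i u v ∨ SeesUp W p i v u)
    (C : G.ConnectedComponent) (hC : C.supp ⊆ W) : IsOrthRep T C.supp i p := by
  refine ⟨fun u hu v hv => hd u (hC hu) v (hC hv), fun u hu v hv _ => ⟨fun h => ?_, ?_⟩⟩
  · have := hT.adj_of_reachable hG (C.reachable_of_mem_supp hu hv) h
    exact (hsees u (hC hu) v (hC hv) this).imp (fun h => h.mono hC) fun h => h.mono hC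
  · rintro (h | h)
    · exact hadj u (hC hu) v (hC hv) (h.of_isAcyclic hT hG hd hadj C hC hu hv)
    · exact (hadj v (hC hv) u (hC hu) (h.of_isAcyclic hT hG hd hadj C hC hv hu)).symm

theorem SimpleGraph.ConnectedComponent.supp_subset_supp_map {V : Type*} {G G' : SimpleGraph V}
    (h : G ≤ G') (C : G.ConnectedComponent) :
    C.supp ⊆ (C.map (SimpleGraph.Hom.ofLE h)).supp := by
  intro v hv
  rw [SimpleGraph.ConnectedComponent.mem_supp_iff] at hv ⊢
  subst hv
  rfl

theorem OrthForest.anti {V : Type*} [Finite V] {m : ℕ} {T G G' : SimpleGraph V}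
    (hT : T.IsAcyclic) (hG : G ≤ T) (h : OrthForest m T G) (hG' : G' ≤ G) :
    OrthForest m T G' := by
  intro C
  obtain ⟨p, hp⟩ := h (C.map (SimpleGraph.Hom.ofLE hG'))
  refine ⟨p, isOrthRep_of_isAcyclic hT (hG'.trans hG) hp.disjoint ?_ ?_ C
    (C.supp_subset_supp_map hG')⟩
  · intro u hu v hv h
    have hne : u ≠ v := by rintro rfl; exact lt_irrefl _ h.1
    exact (hp.adj_iff u hu v hv hne).2 (.inl h)
  · intro u hu v hv h
    exact (hp.adj_iff u hu v hv h.ne).1 (hG (hG' h))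

/-! ### Translation to vertex sets -/

theorem isCubeOrthVisGraph_iff {U V : Type*} [Finite U] {m : ℕ} (T : SimpleGraph V) (f : U → V)
    (hf : Function.Injective f) (G : SimpleGraph U) (hG : ∀ a b, G.Adj a b ↔ T.Adj (f a) (f b)) :
    IsCubeOrthVisGraph m G ↔ ∃ p, IsOrthRep T (Set.range f) (Fin.last m) p := by
  have key : ∀ p : V → Fin (m + 1) → ℝ, IsOrthRep T (Set.range f) (Fin.last m) p ↔
      (∀ u v, u ≠ v → Disjoint (flatCube (p (f u))) (flatCube (p (f v)))) ∧
      ∀ u v, u ≠ v → (G.Adj u v ↔ SeesAlong (fun w => flatCube (p (f w))) (Fin.last m) u v) := by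
    intro p
    simp only [SeesAlong, hasChannel_flatCube_iff (fun w => p (f w)), ← seesUp_range f p, hG,
      disjoint_flatCube_iff]
    constructor
    · rintro ⟨h1, h2⟩
      exact ⟨fun u v huv => h1 _ ⟨u, rfl⟩ _ ⟨v, rfl⟩ (hf.ne huv),
        fun u v huv => h2 _ ⟨u, rfl⟩ _ ⟨v, rfl⟩ (hf.ne huv)⟩
    · rintro ⟨h1, h2⟩
      refine ⟨?_, ?_⟩
      · rintro _ ⟨u, rfl⟩ _ ⟨v, rfl⟩ huv
        exact h1 u v fun e => huv (e ▸ rfl)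
      · rintro _ ⟨u, rfl⟩ _ ⟨v, rfl⟩ huv
        exact h2 u v fun e => huv (e ▸ rfl)
  simp only [key]
  constructor
  · rintro ⟨q, hq⟩
    -- Positions outside the range are irrelevant; the default `0` puts all representations on the
    -- one vertex type `V`.
    refine ⟨Function.extend f q 0, ?_⟩
    simpa only [hf.extend_apply] using hq
  · rintro ⟨p, hp⟩
    exact ⟨fun u => p (f u), hp⟩

theorem isCubeVisGraph_iff {U V : Type*} [Finite U] {m : ℕ} (T : SimpleGraph V) (f : U → V)
    (hf : Function.Injective f) (G : SimpleGraph U) (hG : ∀ a b, G.Adj a b ↔ T.Adj (f a) (f b)) :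
    IsCubeVisGraph m G ↔ ∃ p : V → Fin m → ℝ, IsCubeRep T (Set.range f) p := by
  have key : ∀ p : V → Fin m → ℝ, IsCubeRep T (Set.range f) p ↔
      (∀ u v, u ≠ v → Disjoint (unitCube (p (f u))) (unitCube (p (f v)))) ∧
      ∀ u v, u ≠ v → (G.Adj u v ↔ ∃ i, SeesAlong (fun w => unitCube (p (f w))) i u v) := by
    intro p
    have h0 : IsCubeRep T (Set.range f) p ↔
        (∀ u v, u ≠ v → Disjoint (unitCube (p (f u))) (unitCube (p (f v)))) ∧
        ∀ u v, u ≠ v → (T.Adj (f u) (f v) ↔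
          ∃ i, SeesUp (Set.range f) p i (f u) (f v) ∨ SeesUp (Set.range f) p i (f v) (f u)) := by
      simp only [disjoint_unitCube_iff]
      constructor
      · rintro ⟨h1, h2⟩
        exact ⟨fun u v huv => h1 _ ⟨u, rfl⟩ _ ⟨v, rfl⟩ (hf.ne huv),
          fun u v huv => h2 _ ⟨u, rfl⟩ _ ⟨v, rfl⟩ (hf.ne huv)⟩
      · rintro ⟨h1, h2⟩
        refine ⟨?_, ?_⟩
        · rintro _ ⟨u, rfl⟩ _ ⟨v, rfl⟩ huv
          exact h1 u v fun e => huv (e ▸ rfl)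
        · rintro _ ⟨u, rfl⟩ _ ⟨v, rfl⟩ huv
          exact h2 u v fun e => huv (e ▸ rfl)
    rw [h0]
    refine and_congr_right fun hd => ?_
    simp only [SeesAlong, hasChannel_unitCube_iff (fun w => p (f w)) _ _ _ hd,
      ← seesUp_range f p, hG]
  simp only [key]
  constructor
  · rintro ⟨q, hq⟩
    refine ⟨Function.extend f q 0, ?_⟩
    simpa only [hf.extend_apply] using hq
  · rintro ⟨p, hp⟩
    exact ⟨fun u => p (f u), hp⟩

theorem SimpleGraph.Subgraph.reachable_spanningCoe_of_coe {V : Type*} {T : SimpleGraph V}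
    (F : T.Subgraph) {a b : F.verts} (h : F.coe.Reachable a b) :
    F.spanningCoe.Reachable (a : V) b :=
  h.map (⟨Subtype.val, fun h => h⟩ : F.coe →g F.spanningCoe)

theorem SimpleGraph.Subgraph.exists_reachable_coe {V : Type*} {T : SimpleGraph V}
    (F : T.Subgraph) {a b : V} (ha : a ∈ F.verts) (h : F.spanningCoe.Reachable a b) :
    ∃ hb : b ∈ F.verts, F.coe.Reachable ⟨a, ha⟩ ⟨b, hb⟩ := by
  obtain ⟨w⟩ := h
  induction w with
  | nil => exact ⟨ha, .rfl⟩
  | cons hadj _ ih =>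
    obtain ⟨hb, hr⟩ := ih (F.edge_vert (show F.Adj _ _ from hadj).symm)
    exact ⟨hb, .trans (SimpleGraph.Adj.reachable (by simpa using hadj)) hr⟩

/-- The properties of the components of a subgraph as a graph on its own, and as a spanning
subgraph, agree, if they hold for single vertices. -/
theorem SimpleGraph.Subgraph.forall_component_iff {V : Type*} {T : SimpleGraph V}
    (hT : T.IsAcyclic) (F : T.Subgraph) (P : Set V → Prop) (hP : ∀ v, P {v})
    (Q : ∀ C : F.coe.ConnectedComponent, SimpleGraph C → Prop)
    (hQ : ∀ C : F.coe.ConnectedComponent, Q C C.toSimpleGraph ↔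
      P (Set.range fun z : C => (z : F.verts).1)) :
    (∀ C : F.coe.ConnectedComponent, C.toSimpleGraph.IsTree ∧ Q C C.toSimpleGraph) ↔
      ∀ C : F.spanningCoe.ConnectedComponent, P C.supp := by
  have htree : ∀ C : F.coe.ConnectedComponent, C.toSimpleGraph.IsTree := fun C =>
    (hT.subgraph F).isTree_connectedComponent C
  have hr : ∀ v : F.verts, (Set.range fun z : F.coe.connectedComponentMk v => (z : F.verts).1) =
      (F.spanningCoe.connectedComponentMk (v : V)).supp := by
    intro v
    ext w
    simp only [Set.mem_range, SimpleGraph.ConnectedComponent.mem_supp_iff,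
      SimpleGraph.ConnectedComponent.eq]
    constructor
    · rintro ⟨⟨z, hz⟩, rfl⟩
      exact F.reachable_spanningCoe_of_coe (SimpleGraph.ConnectedComponent.exact hz)
    · intro h
      obtain ⟨hb, hr⟩ := F.exists_reachable_coe v.2 h.symm
      exact ⟨⟨⟨w, hb⟩, SimpleGraph.ConnectedComponent.sound hr.symm⟩, rfl⟩
  constructor
  · intro h C
    induction C using SimpleGraph.ConnectedComponent.ind with
    | _ v =>
      by_cases hv : v ∈ F.verts
      · rw [← hr ⟨v, hv⟩]
        exact (hQ _).1 (h _).2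
      -- A vertex outside `F` is isolated in the spanning subgraph.
      · convert hP v
        ext w
        rw [SimpleGraph.ConnectedComponent.mem_supp_iff, SimpleGraph.ConnectedComponent.eq,
          Set.mem_singleton_iff]
        constructor
        · rintro ⟨q⟩
          cases q.reverse with
          | nil => rfl
          | cons hadj _ => exact (hv (F.edge_vert hadj)).elim
        · rintro rfl; exact .rfl
  · intro h C
    refine ⟨htree C, (hQ C).2 ?_⟩
    induction C using SimpleGraph.ConnectedComponent.ind with
    | _ v =>
      rw [hr v]
      exact h _

theorem SimpleGraph.IsAcyclic.component_adj_iff {V : Type*} {T : SimpleGraph V}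
    (hT : T.IsAcyclic) (F : T.Subgraph) (C : F.coe.ConnectedComponent) (a b : C) :
    C.toSimpleGraph.Adj a b ↔ T.Adj (a : F.verts).1 (b : F.verts).1 := by
  constructor
  · intro h
    exact F.adj_sub (show F.Adj _ _ from h)
  · intro h
    have := F.reachable_spanningCoe_of_coe (C.reachable_of_mem_supp a.2 b.2)
    exact hT.adj_of_reachable F.spanningCoe_le this h

theorem isCubeOrthVisForest_iff {V : Type*} [Finite V] {m : ℕ} {T : SimpleGraph V}
    (hT : T.IsAcyclic) (F : T.Subgraph) :
    IsCubeOrthVisForest m F.coe ↔ OrthForest m T F.spanningCoe :=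
  F.forall_component_iff hT (fun W => ∃ p, IsOrthRep T W (Fin.last m) p)
    (fun v => ⟨0, ⟨by rintro u rfl w rfl h; exact (h rfl).elim,
      by rintro u rfl w rfl h; exact (h rfl).elim⟩⟩) (fun C => IsCubeOrthVisGraph m)
    fun C => isCubeOrthVisGraph_iff T _
      (Subtype.val_injective.comp Subtype.val_injective) _ (hT.component_adj_iff F C)

theorem isCubeVisForest_iff {V : Type*} [Finite V] {m : ℕ} {T : SimpleGraph V}
    (hT : T.IsAcyclic) (F : T.Subgraph) :
    IsCubeVisForest m F.coe ↔ CubeForest m T F.spanningCoe :=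
  F.forall_component_iff hT (fun W => ∃ p : V → Fin m → ℝ, IsCubeRep T W p)
    (fun v => ⟨0, ⟨by rintro u rfl w rfl h; exact (h rfl).elim,
      by rintro u rfl w rfl h; exact (h rfl).elim⟩⟩) (fun C => IsCubeVisGraph m)
    fun C => isCubeVisGraph_iff T _
      (Subtype.val_injective.comp Subtype.val_injective) _ (hT.component_adj_iff F C)

/-- Being a union of `k` subgraphs of some kind, in terms of spanning subgraphs. -/
theorem exists_iSup_subgraph_iff {V : Type*} [Nonempty V] (T : SimpleGraph V) (k : ℕ)
    (P : SimpleGraph V → Prop) :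
    (∃ F : Fin k → T.Subgraph, (∀ j, P (F j).spanningCoe) ∧ ⨆ j, F j = ⊤) ↔
      0 < k ∧ ∃ G : Fin k → SimpleGraph V, (∀ j, P (G j)) ∧ ⨆ j, G j = T := by
  constructor
  · rintro ⟨F, hF, htop⟩
    refine ⟨?_, fun j => (F j).spanningCoe, hF, ?_⟩
    -- An empty union covers no vertex; passing to spanning subgraphs would lose this, hence the
    -- condition `0 < k`.
    · rcases Nat.eq_zero_or_pos k with rfl | hk
      · obtain ⟨v⟩ := ‹Nonempty V›
        have : v ∈ (⨆ j, F j).verts := htop ▸ Set.mem_univ v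
        simp at this
      · exact hk
    · ext a b
      rw [SimpleGraph.iSup_adj]
      have : (⨆ j, F j).Adj a b ↔ T.Adj a b := by rw [htop]; simp
      rw [← this, SimpleGraph.Subgraph.iSup_adj]
      rfl
  · rintro ⟨hk, G, hG, htop⟩
    have hle : ∀ j, G j ≤ T := fun j => htop ▸ le_iSup G j
    refine ⟨fun j => SimpleGraph.toSubgraph (G j) (hle j), fun j => ?_, ?_⟩
    · have : (SimpleGraph.toSubgraph (G j) (hle j)).spanningCoe = G j := rfl
      rw [this]
      exact hG j
    · ext a b
      · simp [SimpleGraph.Subgraph.verts_iSup]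
        exact ⟨⟨0, hk⟩⟩
      · rw [SimpleGraph.Subgraph.iSup_adj]
        simp only [SimpleGraph.toSubgraph_adj, SimpleGraph.Subgraph.top_adj]
        rw [← htop, SimpleGraph.iSup_adj]

theorem isUnionOfCubeOrthVisForests_iff {V : Type*} [Finite V] [Nonempty V] {m : ℕ}
    {T : SimpleGraph V} (hT : T.IsAcyclic) (k : ℕ) :
    IsUnionOfCubeOrthVisForests m T k ↔
      0 < k ∧ ∃ G : Fin k → SimpleGraph V, (∀ j, OrthForest m T (G j)) ∧ ⨆ j, G j = T := by
  rw [← exists_iSup_subgraph_iff]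
  simp only [IsUnionOfCubeOrthVisForests, isCubeOrthVisForest_iff hT]

theorem isUnionOfCubeVisForests_iff {V : Type*} [Finite V] [Nonempty V] {m : ℕ}
    {T : SimpleGraph V} (hT : T.IsAcyclic) (k : ℕ) :
    IsUnionOfCubeVisForests m T k ↔
      0 < k ∧ ∃ G : Fin k → SimpleGraph V, (∀ j, CubeForest m T (G j)) ∧ ⨆ j, G j = T := by
  rw [← exists_iSup_subgraph_iff]
  simp only [IsUnionOfCubeVisForests, isCubeVisForest_iff hT]

/-! ### Gates of connected subsets of a tree -/

/-- `T` without the edges of the component `C` of `A`. -/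
abbrev SimpleGraph.cutComponent {V : Type*} (T : SimpleGraph V) {A : SimpleGraph V}
    (C : A.ConnectedComponent) : SimpleGraph V :=
  T \ C.toSimpleGraph.spanningCoe

theorem SimpleGraph.cutComponent_adj {V : Type*} {T A : SimpleGraph V}
    {C : A.ConnectedComponent} {v w : V} :
    (T.cutComponent C).Adj v w ↔ T.Adj v w ∧ ¬ (v ∈ C.supp ∧ A.Adj v w) := by
  rw [SimpleGraph.cutComponent, SimpleGraph.sdiff_adj, C.adj_spanningCoe_toSimpleGraph]

/-- Otherwise the tree path from `u` to `v` would run both in `C` and in the graph without the edges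
of `C`. So gates are unique. -/
theorem SimpleGraph.IsTree.eq_of_reachable_cutComponent {V : Type*} {T A : SimpleGraph V}
    (hT : T.IsTree) (hA : A ≤ T) {C : A.ConnectedComponent} {u v : V} (hu : u ∈ C.supp)
    (hv : v ∈ C.supp) (h : (T.cutComponent C).Reachable u v) : u = v := by
  obtain ⟨q, hq, -⟩ := hT.existsUnique_path u v
  obtain ⟨q₁, h₁⟩ := hT.isAcyclic.exists_mapLe_eq hA (C.reachable_of_mem_supp hu hv) q hq
  obtain ⟨q₂, h₂⟩ := hT.isAcyclic.exists_mapLe_eq sdiff_le h q hq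
  cases q with
  | nil => rfl
  | @cons _ x _ hadj q =>
    have e₁ : s(u, x) ∈ q₁.edges := by
      rw [← SimpleGraph.Walk.edges_mapLe_eq_edges hA, h₁]; simp
    have e₂ : s(u, x) ∈ q₂.edges := by
      rw [← SimpleGraph.Walk.edges_mapLe_eq_edges (sdiff_le : T.cutComponent C ≤ T), h₂]; simp
    exact absurd ⟨hu, q₁.adj_of_mem_edges e₁⟩
      (SimpleGraph.cutComponent_adj.1 (q₂.adj_of_mem_edges e₂)).2

/-- Walk towards `C` and stop on arrival: every edge used starts outside `C`, so none is cut. -/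
theorem SimpleGraph.IsTree.exists_gate {V : Type*} {T A : SimpleGraph V} (hT : T.IsTree)
    (C : A.ConnectedComponent) :
    ∃ g : V → V, ∀ v, g v ∈ C.supp ∧ (T.cutComponent C).Reachable v (g v) := by
  rw [← Classical.skolem (p := fun v c => c ∈ C.supp ∧ (T.cutComponent C).Reachable v c)]
  intro v
  obtain ⟨c, hc⟩ := C.nonempty_supp
  obtain ⟨q⟩ := hT.connected.preconnected v c
  induction q with
  | nil => exact ⟨_, hc, .rfl⟩
  | @cons x y _ hadj _ ih =>
    by_cases hx : x ∈ C.supp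
    · exact ⟨x, hx, .rfl⟩
    · obtain ⟨d, hd, hr⟩ := ih hc
      exact ⟨d, hd, .trans (SimpleGraph.cutComponent_adj.2 ⟨hadj, fun h => hx h.1⟩).reachable hr⟩

/-- An edge of the tree path that belongs to `E j` with `j ≠ i` would be cut with its own component.
Contrapositively, vertices in different components of `E i` get different gates for another axis. -/
theorem SimpleGraph.IsTree.reachable_of_cutComponent {V ι : Type*} {T : SimpleGraph V}
    (hT : T.IsTree) {E : ι → SimpleGraph V} (hE : ∀ i, E i ≤ T) {a b : V}
    (hab : (⨆ i, E i).Reachable a b) (i : ι)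
    (h : ∀ j, j ≠ i → ∀ C : (E j).ConnectedComponent, (T.cutComponent C).Reachable a b) :
    (E i).Reachable a b := by
  obtain ⟨q, hq, -⟩ := hT.existsUnique_path a b
  obtain ⟨q', hq'⟩ := hT.isAcyclic.exists_mapLe_eq (iSup_le hE) hab q hq
  refine ⟨q.transfer (E i) fun e he => ?_⟩
  induction e using Sym2.ind with
  | _ x y =>
    have hH : (⨆ i, E i).Adj x y := by
      refine q'.adj_of_mem_edges ?_
      rw [← SimpleGraph.Walk.edges_mapLe_eq_edges (iSup_le hE), hq']; exact he
    obtain ⟨j, hj⟩ := SimpleGraph.iSup_adj.1 hH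
    by_cases hji : j = i
    · subst hji; exact hj
    · obtain ⟨q₂, h₂⟩ := hT.isAcyclic.exists_mapLe_eq sdiff_le
        (h j hji ((E j).connectedComponentMk x)) q hq
      have e₂ : s(x, y) ∈ q₂.edges := by
        rw [← SimpleGraph.Walk.edges_mapLe_eq_edges
          (sdiff_le : T.cutComponent ((E j).connectedComponentMk x) ≤ T), h₂]; exact he
      exact absurd ⟨rfl, hj⟩ (SimpleGraph.cutComponent_adj.1 (q₂.adj_of_mem_edges e₂)).2

theorem SimpleGraph.reachable_cutComponent_of_reachable {V ι : Type*} {T : SimpleGraph V}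
    {E : ι → SimpleGraph V} (hE : ∀ i, E i ≤ T) (hdis : Pairwise (Function.onFun Disjoint E))
    (s : Σ i, (E i).ConnectedComponent) {i : ι} {a b : V} (hab : (E i).Reachable a b)
    (hs : s ≠ ⟨i, (E i).connectedComponentMk a⟩) : (T.cutComponent s.2).Reachable a b := by
  obtain ⟨q⟩ := hab
  induction q with
  | nil => exact .rfl
  | @cons x y _ hadj _ ih =>
    have hxy : (E i).connectedComponentMk x = (E i).connectedComponentMk y :=
      SimpleGraph.ConnectedComponent.sound hadj.reachable
    refine .trans (SimpleGraph.cutComponent_adj.2 ⟨hE i hadj, ?_⟩).reachable (ih (hxy ▸ hs))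
    rintro ⟨hx, hadj'⟩
    obtain ⟨j, C⟩ := s
    have hji : j = i := by
      by_contra hne
      exact SimpleGraph.disjoint_left.1 (hdis hne) _ _ hadj' hadj
    subst hji
    rw [SimpleGraph.ConnectedComponent.mem_supp_iff] at hx
    exact hs (by simpa using hx.symm)

/-! ### Heights -/

/-- Ties in height are broken by an enumeration of `V`; the rank counts the smaller elements. -/
theorem exists_injective_rank {V : Type*} [Finite V] (h : V → ℝ) :
    ∃ rk : V → ℕ, Function.Injective rk ∧ ∀ a b, h a < h b → rk a < rk b := by
  obtain ⟨n, ⟨e⟩⟩ := Finite.exists_equiv_fin V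
  set f : V → ℝ ×ₗ Fin n := fun v => toLex (h v, e v) with hf
  have hinj : Function.Injective f := by
    intro a b hab
    have := congrArg (fun z => (ofLex z).2) hab
    exact e.injective this
  have hlt : ∀ a b, f a < f b → {c | f c < f a}.ncard < {c | f c < f b}.ncard := fun a b hab =>
    Set.ncard_lt_ncard ⟨fun c hc => lt_trans hc hab, fun hsub => lt_irrefl (f a) (hsub hab)⟩
      (Set.toFinite _)
  refine ⟨fun a => {c | f c < f a}.ncard, fun a b hab => ?_, fun a b hab => hlt a b ?_⟩
  · rcases lt_trichotomy (f a) (f b) with h | h | h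
    · exact absurd hab (hlt a b h).ne
    · exact hinj h
    · exact absurd hab (hlt b a h).ne'
  · exact Prod.Lex.toLex_lt_toLex.2 (.inl hab)

/-- Visibility is not affected by translations and by changes of height that keep the order of
overlapping cubes. -/
theorem SeesUp.of_translate {V : Type*} {m : ℕ} {W : Set V} {p q : V → Fin m → ℝ} {i : Fin m}
    (c : Fin m → ℝ) (hk : ∀ w ∈ W, ∀ k, k ≠ i → q w k = p w k + c k)
    (hi : ∀ x : Fin m → ℝ, ∀ u ∈ W, ∀ v ∈ W, (∀ k, k ≠ i → p u k ≤ x k ∧ x k ≤ p u k + 1) →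
      (∀ k, k ≠ i → p v k ≤ x k ∧ x k ≤ p v k + 1) → (p u i < p v i ↔ q u i < q v i))
    {a b : V} (ha : a ∈ W) (hb : b ∈ W) (h : SeesUp W p i a b) : SeesUp W q i a b := by
  obtain ⟨h1, x, hxa, hxb, hw⟩ := h
  have hxa' : ∀ k, k ≠ i → p a k ≤ x k ∧ x k ≤ p a k + 1 :=
    fun k hk => ⟨(hxa k hk).1.le, (hxa k hk).2.le⟩
  have hxb' : ∀ k, k ≠ i → p b k ≤ x k ∧ x k ≤ p b k + 1 :=
    fun k hk => ⟨(hxb k hk).1.le, (hxb k hk).2.le⟩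
  refine ⟨(hi x a ha b hb hxa' hxb').1 h1, fun k => x k + c k, fun k hk' => ?_, fun k hk' => ?_,
    fun w hw' h2 h3 h4 => ?_⟩
  · have := hxa k hk'
    rw [hk a ha k hk']; constructor <;> linarith
  · have := hxb k hk'
    rw [hk b hb k hk']; constructor <;> linarith
  · have hxw : ∀ k, k ≠ i → p w k ≤ x k ∧ x k ≤ p w k + 1 := by
      intro k hk'
      have := h4 k hk'
      rw [hk w hw' k hk'] at this; constructor <;> linarith
    exact hw w hw' ((hi x _ ha _ hw' hxa' hxw).2 h2) ((hi x _ hw' _ hb hxw hxb').2 h3) hxw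

/-- The heights in a representation may be taken to be distinct natural numbers. -/
theorem IsOrthRep.exists_rank {V : Type*} [Finite V] {m : ℕ} {T : SimpleGraph V} {W : Set V}
    {i : Fin m} {p : V → Fin m → ℝ} (h : IsOrthRep T W i p) :
    ∃ (q : V → Fin m → ℝ) (rk : V → ℕ), IsOrthRep T W i q ∧ Function.Injective rk ∧
      ∀ v, q v i = rk v := by
  obtain ⟨rk, hinj, hrk⟩ := exists_injective_rank fun v => p v i
  set q : V → Fin m → ℝ := fun v => Function.update (p v) i (rk v) with hq
  have hqi : ∀ v, q v i = rk v := fun v => by simp [hq]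
  have hqk : ∀ v k, k ≠ i → q v k = p v k := fun v k hk => by simp [hq, Function.update_of_ne hk]
  have hiff : ∀ (x : Fin m → ℝ), ∀ u ∈ W, ∀ v ∈ W,
      (∀ k, k ≠ i → p u k ≤ x k ∧ x k ≤ p u k + 1) →
      (∀ k, k ≠ i → p v k ≤ x k ∧ x k ≤ p v k + 1) → (p u i < p v i ↔ q u i < q v i) := by
    intro x u hu v hv hxu hxv
    rw [hqi, hqi, Nat.cast_lt]
    refine ⟨hrk u v, fun hlt => ?_⟩
    rcases lt_trichotomy (p u i) (p v i) with h' | h' | h'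
    · exact h'
    -- The order given to ties is harmless: cubes at equal height have disjoint projections.
    · obtain ⟨k, hk, hk'⟩ := h.disjoint u hu v hv (by rintro rfl; exact lt_irrefl _ hlt) h'
      have h1 := hxu k hk
      have h2 := hxv k hk
      rcases lt_abs.1 hk' with h | h <;> linarith
    · exact absurd (hrk v u h') hlt.not_gt
  have hsees : ∀ a ∈ W, ∀ b ∈ W, SeesUp W q i a b ↔ SeesUp W p i a b := by
    intro a ha b hb
    refine ⟨.of_translate 0 (fun w _ k hk => by simp [hqk w k hk]) (fun x u hu v hv hxu hxv => ?_)
      ha hb, .of_translate 0 (fun w _ k hk => by simp [hqk w k hk]) hiff ha hb⟩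
    refine (hiff x u hu v hv (fun k hk => ?_) fun k hk => ?_).symm
    · rw [← hqk u k hk]; exact hxu k hk
    · rw [← hqk v k hk]; exact hxv k hk
  refine ⟨q, rk, ⟨fun u hu v hv huv he => ?_, fun u hu v hv huv => ?_⟩, hinj, hqi⟩
  · rw [hqi, hqi, Nat.cast_inj] at he
    exact (huv (hinj he)).elim
  · rw [hsees u hu v hv, hsees v hv u hu]
    exact h.adj_iff u hu v hv huv

/-- Large factors for the members of a family of integer-valued functions keep apart any two
arguments that some member of the family distinguishes. -/
theorem exists_scale {ι V κ : Type*} [Fintype ι] [Finite V] [Finite κ] [DecidableEq κ]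
    (col : ι → κ) (rk : ι → V → ℕ) (f : ι → V → κ → ℝ) :
    ∃ L : ι → ℝ, (∀ s, 0 < L s) ∧ ∀ a b k, (∃ s, col s = k ∧ rk s a ≠ rk s b) →
      1 < |(∑ s, if col s = k then L s * rk s a else f s a k) -
        ∑ s, if col s = k then L s * rk s b else f s b k| := by
  classical
  let idx := Fintype.equivFin ι
  -- The factors will be distinct powers of one large `B`. If some rank differs, the difference of
  -- two sums is a nonconstant polynomial in `B`; the exponent shift by one keeps ranks apart from
  -- the constants `f`.
  let Q : V → κ → Polynomial ℝ := fun v k => ∑ s,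
    if col s = k then Polynomial.monomial ((idx s : ℕ) + 1) (rk s v : ℝ)
    else Polynomial.C (f s v k)
  have hcoeff : ∀ v k s, col s = k → (Q v k).coeff ((idx s : ℕ) + 1) = rk s v := by
    intro v k s hs
    simp only [Q, Polynomial.finsetSum_coeff]
    rw [Finset.sum_eq_single s]
    · simp [hs]
    · intro t _ hts
      split_ifs
      · rw [Polynomial.coeff_monomial, if_neg]
        intro h
        exact hts (idx.injective (Fin.ext (by omega)))
      · simp
    · simp
  have hev : ∀ᶠ B : ℝ in Filter.atTop, ∀ a b k, (∃ s, col s = k ∧ rk s a ≠ rk s b) →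
      1 < |(Q a k - Q b k).eval B| := by
    simp only [Filter.eventually_all]
    rintro a b k ⟨s, hs, hne⟩
    refine (Polynomial.abs_tendsto_atTop _ ?_).eventually_gt_atTop 1
    have hc : (Q a k - Q b k).coeff ((idx s : ℕ) + 1) ≠ 0 := by
      rw [Polynomial.coeff_sub, hcoeff a k s hs, hcoeff b k s hs, sub_ne_zero]
      exact_mod_cast hne
    refine lt_of_lt_of_le ?_ (Polynomial.le_degree_of_ne_zero hc)
    exact_mod_cast Nat.succ_pos _
  obtain ⟨B, hB, hB0⟩ := (hev.and (Filter.eventually_gt_atTop 0)).exists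
  refine ⟨fun s => B ^ ((idx s : ℕ) + 1), fun s => by positivity, fun a b k h => ?_⟩
  have heval : ∀ v, (Q v k).eval B = ∑ s, if col s = k then
      B ^ ((idx s : ℕ) + 1) * (rk s v : ℝ) else f s v k := by
    intro v
    simp only [Q, Polynomial.eval_finsetSum]
    refine Finset.sum_congr rfl fun s _ => ?_
    split_ifs
    · rw [Polynomial.eval_monomial, mul_comm]
    · simp
  have := hB a b k h
  rwa [Polynomial.eval_sub, heval, heval] at this

/-! ### Combining visibility forests for the different axes -/

/-- If a tree has edge-disjoint subgraphs, one for each axis, whose components are `m`-cube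
orthogonal visibility graphs, then the components of their union are `(m + 1)`-cube visibility
graphs. -/
theorem cubeForest_iSup {V : Type*} [Finite V] {m : ℕ} {T : SimpleGraph V} (hT : T.IsTree)
    (E : Fin (m + 1) → SimpleGraph V) (hE : ∀ i, E i ≤ T)
    (hdis : Pairwise (Function.onFun Disjoint E)) (h : ∀ i, OrthForest m T (E i)) :
    CubeForest (m + 1) T (⨆ i, E i) := by
  classical
  have hrep : ∀ s : Σ i, (E i).ConnectedComponent, ∃ (q : V → Fin (m + 1) → ℝ) (rk : V → ℕ),
      IsOrthRep T s.2.supp s.1 q ∧ Function.Injective rk ∧ ∀ v, q v s.1 = rk v := fun s => by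
    obtain ⟨p, hp⟩ := h s.1 s.2
    obtain ⟨p', hp'⟩ := hp.exists_axis s.1
    exact hp'.exists_rank
  choose p rk hp hrk hprk using hrep
  choose g hg using fun s : Σ i, (E i).ConnectedComponent => hT.exists_gate s.2
  have := Fintype.ofFinite (Σ i, (E i).ConnectedComponent)
  have hgate : ∀ s v, v ∈ s.2.supp → g s v = v := fun s v hv =>
    (hT.eq_of_reachable_cutComponent (hE s.1) hv (hg s v).1 (hg s v).2).symm
  have hgate_eq : ∀ s a b, (T.cutComponent s.2).Reachable a b → g s a = g s b := fun s a b hab =>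
    hT.eq_of_reachable_cutComponent (hE s.1) (hg s a).1 (hg s b).1
      (((hg s a).2.symm.trans hab).trans (hg s b).2)
  have hgate_ne : ∀ s a b, ¬ (T.cutComponent s.2).Reachable a b → g s a ≠ g s b :=
    fun s a b hab he => hab ((hg s a).2.trans (he ▸ (hg s b).2.symm))
  obtain ⟨L, hL, hfar⟩ := exists_scale (fun s : Σ i, (E i).ConnectedComponent => s.1)
    (fun s v => rk s (g s v)) (fun s v k => p s (g s v) k)
  -- Only the coordinate along the axis of `s` is scaled; the others must keep the unit side length
  -- of the cubes.
  set P : V → Fin (m + 1) → ℝ := fun v k => ∑ s : Σ i, (E i).ConnectedComponent,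
    if s.1 = k then L s * (rk s (g s v) : ℕ) else p s (g s v) k with hP
  have hfar' : ∀ a b s, g s a ≠ g s b → 1 < |P a s.1 - P b s.1| := fun a b s hne =>
    hfar a b s.1 ⟨s, rfl, (hrk s).ne hne⟩
  -- the positions within one component
  have hdiff : ∀ s a b k, a ∈ s.2.supp → b ∈ s.2.supp → P a k - P b k =
      (if s.1 = k then L s * (rk s a : ℕ) else p s a k) -
      (if s.1 = k then L s * (rk s b : ℕ) else p s b k) := by
    intro s a b k ha hb
    simp only [hP]
    rw [← Finset.sum_sub_distrib, Finset.sum_eq_single s]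
    · rw [hgate s a ha, hgate s b hb]
    · intro t _ hts
      rw [hgate_eq t a b (SimpleGraph.reachable_cutComponent_of_reachable hE hdis t
        (s.2.reachable_of_mem_supp ha hb) ?_), sub_self]
      rw [SimpleGraph.ConnectedComponent.mem_supp_iff] at ha
      rw [ha]
      exact hts
    · simp
  intro D
  have hmem : ∀ {i a b}, a ∈ D.supp → (E i).Reachable a b → b ∈ D.supp := by
    intro i a b ha hab
    rw [SimpleGraph.ConnectedComponent.mem_supp_iff] at ha ⊢
    rw [← ha, SimpleGraph.ConnectedComponent.eq]
    exact (hab.mono (le_iSup E i)).symm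
  have hsep : ∀ a ∈ D.supp, ∀ b ∈ D.supp, ∀ i, ¬ (E i).Reachable a b →
      ∃ j, j ≠ i ∧ 1 < |P a j - P b j| := by
    intro a ha b hb i hab
    by_contra! hc
    refine hab (hT.reachable_of_cutComponent hE (D.reachable_of_mem_supp ha hb) i
      fun j hj C => ?_)
    by_contra hr
    exact absurd (hfar' a b ⟨j, C⟩ (hgate_ne ⟨j, C⟩ a b hr)) (not_lt.2 (hc j hj))
  -- two cubes that overlap in the projection along an axis are in the same component for that axis
  have hnear : ∀ a ∈ D.supp, ∀ b ∈ D.supp, ∀ (i : Fin (m + 1)) (x : Fin (m + 1) → ℝ),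
      (∀ k, k ≠ i → P a k ≤ x k ∧ x k ≤ P a k + 1) →
      (∀ k, k ≠ i → P b k ≤ x k ∧ x k ≤ P b k + 1) → (E i).Reachable a b := by
    intro a ha b hb i x hxa hxb
    by_contra hr
    obtain ⟨j, hj, hj'⟩ := hsep a ha b hb i hr
    have h1 := hxa j hj
    have h2 := hxb j hj
    rcases lt_abs.1 hj' with h | h <;> linarith
  have hsees : ∀ a ∈ D.supp, ∀ b ∈ D.supp, ∀ i, SeesUp D.supp P i a b ↔ (E i).Reachable a b ∧
      SeesUp ((E i).connectedComponentMk a).supp (p ⟨i, (E i).connectedComponentMk a⟩) i a b := by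
    intro a ha b hb i
    set s : Σ i, (E i).ConnectedComponent := ⟨i, (E i).connectedComponentMk a⟩ with hs
    have has : a ∈ s.2.supp := rfl
    have hsD : s.2.supp ⊆ D.supp := fun w hw => hmem ha (s.2.reachable_of_mem_supp has hw)
    have hk : ∀ w ∈ s.2.supp, ∀ k, k ≠ i → P w k = p s w k + (P a k - p s a k) := by
      intro w hw k hk
      have := hdiff s w a k hw has
      rw [if_neg (Ne.symm hk), if_neg (Ne.symm hk)] at this
      linarith
    have hi : ∀ u ∈ s.2.supp, ∀ v ∈ s.2.supp, p s u i < p s v i ↔ P u i < P v i := by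
      intro u hu v hv
      have := hdiff s u v i hu hv
      rw [if_pos rfl, if_pos rfl] at this
      rw [hprk s u, hprk s v, ← sub_neg (a := P u i), this, sub_neg, mul_lt_mul_iff_right₀ (hL s)]
    constructor
    · intro hab
      have hr : (E i).Reachable a b := by
        obtain ⟨-, x, hxa, hxb, -⟩ := hab
        exact hnear a ha b hb i x (fun k hk => ⟨(hxa k hk).1.le, (hxa k hk).2.le⟩)
          (fun k hk => ⟨(hxb k hk).1.le, (hxb k hk).2.le⟩)
      refine ⟨hr, .of_translate (p := P) (fun k => -(P a k - p s a k)) (fun w hw k hk' => ?_)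
        (fun _ u hu v hv _ _ => (hi u hu v hv).symm) has
        (SimpleGraph.ConnectedComponent.sound hr.symm) (hab.mono hsD)⟩
      rw [hk w hw k hk']; ring
    · rintro ⟨hr, hab⟩
      obtain ⟨h1, x, hxa, hxb, hw⟩ := hab.of_translate (fun k => P a k - p s a k) hk
        (fun _ u hu v hv _ _ => hi u hu v hv) has (SimpleGraph.ConnectedComponent.sound hr.symm)
      refine ⟨h1, x, hxa, hxb, fun w hwD h2 h3 h4 => hw w ?_ h2 h3 h4⟩
      exact SimpleGraph.ConnectedComponent.sound (hnear a ha w hwD i x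
        (fun k hk => ⟨(hxa k hk).1.le, (hxa k hk).2.le⟩) h4).symm
  refine ⟨P, fun u hu v hv huv => ?_, fun u hu v hv huv => ?_⟩
  -- Axis `0` is an arbitrary choice. Within one of its components both vertices are their own
  -- gates, so their ranks differ.
  · by_cases hr : (E 0).Reachable u v
    · refine ⟨0, hfar' u v ⟨0, (E 0).connectedComponentMk u⟩ ?_⟩
      rwa [hgate ⟨0, (E 0).connectedComponentMk u⟩ u rfl,
        hgate ⟨0, (E 0).connectedComponentMk u⟩ v (SimpleGraph.ConnectedComponent.sound hr.symm)]
    · obtain ⟨j, -, hj⟩ := hsep u hu v hv 0 hr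
      exact ⟨j, hj⟩
  · have hcomp : ∀ i, (E i).Reachable u v →
        (T.Adj u v ↔ SeesUp D.supp P i u v ∨ SeesUp D.supp P i v u) := by
      intro i hr
      have hvs : v ∈ ((E i).connectedComponentMk u).supp :=
        SimpleGraph.ConnectedComponent.sound hr.symm
      have e : (E i).connectedComponentMk v = (E i).connectedComponentMk u := hvs
      rw [hsees u hu v hv, hsees v hv u hu, and_iff_right hr, and_iff_right hr.symm, e]
      exact (hp ⟨i, (E i).connectedComponentMk u⟩).adj_iff u rfl v hvs huv
    constructor
    · intro hadj
      obtain ⟨i, hi⟩ := SimpleGraph.iSup_adj.1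
        (hT.isAcyclic.adj_of_reachable (iSup_le hE) (D.reachable_of_mem_supp hu hv) hadj)
      exact ⟨i, (hcomp i hi.reachable).1 hadj⟩
    · rintro ⟨i, hi⟩
      refine (hcomp i ?_).2 hi
      rcases hi with hi | hi
      · exact ((hsees u hu v hv i).1 hi).1
      · exact ((hsees v hv u hu i).1 hi).1.symm

/-- As `cubeForest_iSup`, but the subgraphs may share edges. -/
theorem cubeForest_iSup' {V : Type*} [Finite V] {m : ℕ} {T : SimpleGraph V} (hT : T.IsTree)
    (E : Fin (m + 1) → SimpleGraph V) (hE : ∀ i, E i ≤ T) (h : ∀ i, OrthForest m T (E i)) :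
    CubeForest (m + 1) T (⨆ i, E i) := by
  -- Each shared edge stays only in the first forest that has it.
  rw [← iSup_disjointed E]
  exact cubeForest_iSup hT _ (fun i => (disjointed_le E i).trans (hE i)) (disjoint_disjointed E)
    fun i => (h i).anti hT.isAcyclic (hE i) (disjointed_le E i)

theorem exists_cubeForests {V : Type*} [Finite V] {m : ℕ} {T : SimpleGraph V} (hT : T.IsTree)
    {k q : ℕ} (hk : 0 < k) (hkq : k ≤ q * (m + 1)) {G : Fin k → SimpleGraph V}
    (hG : ∀ j, OrthForest m T (G j)) (htop : ⨆ j, G j = T) :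
    ∃ H : Fin q → SimpleGraph V, (∀ j, CubeForest (m + 1) T (H j)) ∧ ⨆ j, H j = T := by
  classical
  have hle : ∀ j, G j ≤ T := fun j => htop ▸ le_iSup G j
  -- Slots beyond `k` are padded with `⊥`, which lies below some `G j` because `0 < k`.
  let E : Fin q → Fin (m + 1) → SimpleGraph V := fun a i =>
    if hj : (finProdFinEquiv (a, i) : ℕ) < k then G ⟨_, hj⟩ else ⊥
  have hE : ∀ a i, ∃ j, E a i ≤ G j := by
    intro a i
    by_cases hj : (finProdFinEquiv (a, i) : ℕ) < k
    · exact ⟨⟨_, hj⟩, by simp only [E, dif_pos hj]; exact le_rfl⟩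
    · exact ⟨⟨0, hk⟩, by simp only [E, dif_neg hj]; exact bot_le⟩
  refine ⟨fun a => ⨆ i, E a i, fun a => cubeForest_iSup' hT _ (fun i => ?_) fun i => ?_, ?_⟩
  · obtain ⟨j, hj⟩ := hE a i
    exact hj.trans (hle j)
  · obtain ⟨j, hj⟩ := hE a i
    exact (hG j).anti hT.isAcyclic (hle j) hj
  · refine le_antisymm (iSup_le fun a => iSup_le fun i => ?_) ?_
    · obtain ⟨j, hj⟩ := hE a i
      exact hj.trans (hle j)
    · rw [← htop]
      refine iSup_le fun j => ?_
      obtain ⟨⟨a, i⟩, hai⟩ := finProdFinEquiv.surjective (Fin.castLE hkq j)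
      refine le_trans ?_ (le_iSup_of_le a (le_iSup (E a) i))
      have hj : (finProdFinEquiv (a, i) : ℕ) = j := by rw [hai]; rfl
      simp only [E]
      rw [dif_pos (by rw [hj]; exact j.2)]
      simp [hj]

/-! ### Splitting a cube visibility forest by axes -/

/-- `SeesUp` mentions only corners, so the same corners serve for the flattened cubes. Each edge
goes to every axis along which it is seen. -/
theorem CubeForest.exists_orthForests {V : Type*} [Finite V] {m : ℕ} {T G : SimpleGraph V}
    (hT : T.IsAcyclic) (hG : G ≤ T) (h : CubeForest (m + 1) T G) :
    ∃ H : Fin (m + 1) → SimpleGraph V, (∀ i, OrthForest m T (H i)) ∧ ⨆ i, H i = G := by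
  choose p hp using h
  let R : Fin (m + 1) → V → V → Prop := fun i u v =>
    G.Adj u v ∧ SeesUp (G.connectedComponentMk u).supp (p (G.connectedComponentMk u)) i u v
  have hR : ∀ i u v, (SimpleGraph.fromRel (R i)).Adj u v ↔ u ≠ v ∧ (R i u v ∨ R i v u) :=
    fun i u v => SimpleGraph.fromRel_adj _ _ _
  have hle : ∀ i, SimpleGraph.fromRel (R i) ≤ G := by
    intro i u v huv
    rcases ((hR i u v).1 huv).2 with h | h
    · exact h.1
    · exact h.1.symm
  refine ⟨fun i => SimpleGraph.fromRel (R i), fun i C => ?_, le_antisymm (iSup_le hle) ?_⟩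
  · set D := C.map (SimpleGraph.Hom.ofLE (hle i)) with hD
    refine (isOrthRep_of_isAcyclic (i := i) (p := p D) hT ((hle i).trans hG) ?_ ?_ ?_ C
      (C.supp_subset_supp_map (hle i))).exists_axis (Fin.last m)
    -- At equal heights the separating coordinate cannot be `i`.
    · intro u hu v hv huv he
      obtain ⟨k, hk⟩ := (hp D).disjoint u hu v hv huv
      refine ⟨k, ?_, hk⟩
      rintro rfl
      rw [he, sub_self, abs_zero] at hk
      linarith
    · intro u hu v hv h
      have hne : u ≠ v := by rintro rfl; exact lt_irrefl _ h.1
      exact ((hp D).adj_iff u hu v hv hne).2 ⟨i, .inl h⟩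
    · intro u hu v hv h
      have hu' : G.connectedComponentMk u = D := hu
      have hv' : G.connectedComponentMk v = D := hv
      refine ((hR i u v).1 h).2.imp (fun h => ?_) fun h => ?_
      · have := h.2; rwa [hu'] at this
      · have := h.2; rwa [hv'] at this
  · intro u v huv
    have hv : v ∈ (G.connectedComponentMk u).supp :=
      SimpleGraph.ConnectedComponent.sound huv.symm.reachable
    obtain ⟨i, hi⟩ := ((hp _).adj_iff u rfl v hv huv.ne).1 (hG huv)
    refine SimpleGraph.iSup_adj.2 ⟨i, (hR i u v).2 ⟨huv.ne, hi.imp (fun h => ⟨huv, h⟩)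
      fun h => ⟨huv.symm, ?_⟩⟩⟩
    have e : G.connectedComponentMk v = G.connectedComponentMk u := hv
    rw [e]; exact h

theorem exists_orthForests {V : Type*} [Finite V] {m k : ℕ} {T : SimpleGraph V}
    (hT : T.IsAcyclic) {G : Fin k → SimpleGraph V} (hG : ∀ j, CubeForest (m + 1) T (G j))
    (htop : ⨆ j, G j = T) :
    ∃ H : Fin (k * (m + 1)) → SimpleGraph V, (∀ j, OrthForest m T (H j)) ∧ ⨆ j, H j = T := by
  have hle : ∀ j, G j ≤ T := fun j => htop ▸ le_iSup G j
  choose H hH hHtop using fun j => (hG j).exists_orthForests hT (hle j)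
  refine ⟨fun j => H (finProdFinEquiv.symm j).1 (finProdFinEquiv.symm j).2, fun j => hH _ _, ?_⟩
  rw [finProdFinEquiv.symm.iSup_comp (g := fun z : Fin k × Fin (m + 1) => H z.1 z.2), iSup_prod]
  simp only [hHtop, htop]

/-! ### Single edges -/

/-- A component is a single vertex or the two ends of one edge, represented by two aligned cubes at
heights `0` and `1`. -/
theorem orthForest_of_forall_adj {V : Type*} {m : ℕ} {T G : SimpleGraph V} (hG : G ≤ T) {a b : V}
    (h : ∀ u v, G.Adj u v → s(u, v) = s(a, b)) : OrthForest m T G := by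
  classical
  intro C
  by_cases hC : ∃ u ∈ C.supp, ∃ v ∈ C.supp, G.Adj u v
  · obtain ⟨u, hu, v, hv, huv⟩ := hC
    have hsupp : ∀ w ∈ C.supp, w = u ∨ w = v := by
      intro w hw
      by_cases hwu : w = u
      · exact .inl hwu
      · obtain ⟨q⟩ := C.reachable_of_mem_supp hw hu
        cases q with
        | nil => exact (hwu rfl).elim
        | cons hadj _ =>
          have : w ∈ s(u, v) := by
            rw [h u v huv, ← h _ _ hadj]; exact Sym2.mem_mk_left _ _
          exact Sym2.mem_iff.1 this
    set p : V → Fin (m + 1) → ℝ := fun w k => if k = Fin.last m ∧ w = v then 1 else 0 with hp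
    have hpk : ∀ w k, k ≠ Fin.last m → p w k = 0 := fun w k hk => by simp [hp, hk]
    have hpv : p v (Fin.last m) = 1 := by simp [hp]
    have hpu : p u (Fin.last m) = 0 := by simp [hp, huv.ne]
    have hsees : SeesUp C.supp p (Fin.last m) u v := by
      refine ⟨by rw [hpu, hpv]; norm_num, fun _ => 1 / 2, fun k hk => ?_, fun k hk => ?_,
        fun w hw h1 h2 => ?_⟩
      · rw [hpk _ _ hk]; norm_num
      · rw [hpk _ _ hk]; norm_num
      · rcases hsupp w hw with rfl | rfl
        · exact (lt_irrefl _ h1).elim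
        · exact (lt_irrefl _ h2).elim
    refine ⟨p, fun x hx y hy hxy he => ?_, fun x hx y hy hxy => ?_⟩
    · rcases hsupp x hx with rfl | rfl <;> rcases hsupp y hy with rfl | rfl
      · exact (hxy rfl).elim
      · rw [hpu, hpv] at he; norm_num at he
      · rw [hpu, hpv] at he; norm_num at he
      · exact (hxy rfl).elim
    · rcases hsupp x hx with rfl | rfl <;> rcases hsupp y hy with rfl | rfl
      · exact (hxy rfl).elim
      · exact iff_of_true (hG huv) (.inl hsees)
      · exact iff_of_true (hG huv).symm (.inr hsees)
      · exact (hxy rfl).elim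
  · have hsub : ∀ x ∈ C.supp, ∀ y ∈ C.supp, x = y := by
      intro x hx y hy
      obtain ⟨q⟩ := C.reachable_of_mem_supp hx hy
      cases q with
      | nil => rfl
      | cons hadj _ =>
        exact (hC ⟨_, hx, _, (C.mem_supp_congr_adj hadj).1 hx, hadj⟩).elim
    exact ⟨0, fun x hx y hy hxy => (hxy (hsub x hx y hy)).elim,
      fun x hx y hy hxy => (hxy (hsub x hx y hy)).elim⟩

theorem exists_iSup_orthForest {V : Type*} [Finite V] [Nonempty V] (m : ℕ) (T : SimpleGraph V) :
    ∃ k, 0 < k ∧ ∃ G : Fin k → SimpleGraph V, (∀ j, OrthForest m T (G j)) ∧ ⨆ j, G j = T := by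
  obtain ⟨k, ⟨e⟩⟩ := Finite.exists_equiv_fin (V × V)
  -- Indexing by all pairs, most of them giving no edge, keeps the count positive even when `T` has
  -- no edges.
  let G : V × V → SimpleGraph V := fun z => T ⊓ SimpleGraph.fromEdgeSet {s(z.1, z.2)}
  obtain ⟨v⟩ := ‹Nonempty V›
  refine ⟨k, Fin.pos (e (v, v)), fun j => G (e.symm j), fun j => ?_, ?_⟩
  · refine orthForest_of_forall_adj inf_le_left (a := (e.symm j).1) (b := (e.symm j).2)
      fun u v huv => ?_
    exact (SimpleGraph.fromEdgeSet_adj _).1 huv.2 |>.1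
  · rw [e.symm.iSup_comp (g := G)]
    refine le_antisymm (iSup_le fun z => inf_le_left) fun a b hab => ?_
    exact SimpleGraph.iSup_adj.2 ⟨(a, b), hab, (SimpleGraph.fromEdgeSet_adj _).2 ⟨rfl, hab.ne⟩⟩

/-! ### The ceiling formula -/

theorem mainTheorem2 {V : Type*} [Finite V] (T : SimpleGraph V) (hT : T.IsTree)
    (n : ℕ) (hn : 1 ≤ n) :
    IsLeast {k | IsUnionOfCubeVisForests n T k} (cubeArboricity n T) ∧
    IsLeast {k | IsUnionOfCubeOrthVisForests (n - 1) T k} (cubeOrthArboricity (n - 1) T) ∧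
    cubeArboricity n T = ⌈(cubeOrthArboricity (n - 1) T : ℚ) / (n : ℚ)⌉₊ := by
  obtain ⟨m, rfl⟩ : ∃ m, n = m + 1 := ⟨n - 1, by omega⟩
  rw [Nat.add_sub_cancel]
  have : Nonempty V := hT.connected.nonempty
  have hcube := isUnionOfCubeVisForests_iff (m := m + 1) hT.isAcyclic
  have horth := isUnionOfCubeOrthVisForests_iff (m := m) hT.isAcyclic
  have hgroup : ∀ k q, IsUnionOfCubeOrthVisForests m T k → k ≤ q * (m + 1) →
      IsUnionOfCubeVisForests (m + 1) T q := by
    intro k q hk hkq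
    obtain ⟨hk0, G, hG, htop⟩ := (horth k).1 hk
    refine (hcube q).2 ⟨?_, exists_cubeForests hT hk0 hkq hG htop⟩
    rcases Nat.eq_zero_or_pos q with rfl | hq
    · omega
    · exact hq
  have hsplit : ∀ k, IsUnionOfCubeVisForests (m + 1) T k →
      IsUnionOfCubeOrthVisForests m T (k * (m + 1)) := by
    intro k hk
    obtain ⟨hk0, G, hG, htop⟩ := (hcube k).1 hk
    exact (horth _).2 ⟨by positivity, exists_orthForests hT.isAcyclic hG htop⟩
  have hex : ∃ k, IsUnionOfCubeOrthVisForests m T k := by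
    obtain ⟨k, hk⟩ := exists_iSup_orthForest m T
    exact ⟨k, (horth k).2 hk⟩
  have hex' : ∃ k, IsUnionOfCubeVisForests (m + 1) T k := by
    obtain ⟨k, hk⟩ := hex
    exact ⟨k, hgroup k k hk (Nat.le_mul_of_pos_right k (Nat.succ_pos m))⟩
  have hl : ∀ {Q : ℕ → Prop}, (∃ k, Q k) → IsLeast {k | Q k} (sInf {k | Q k}) := fun hQ =>
    ⟨Nat.sInf_mem hQ, fun _ hk => Nat.sInf_le hk⟩
  have h1 : IsLeast {k | IsUnionOfCubeVisForests (m + 1) T k} (cubeArboricity (m + 1) T) := hl hex'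
  have h2 : IsLeast {k | IsUnionOfCubeOrthVisForests m T k} (cubeOrthArboricity m T) := hl hex
  refine ⟨h1, h2, ?_⟩
  have hpos : (0 : ℚ) < ((m + 1 : ℕ) : ℚ) := by positivity
  -- For `≤`, group a minimal orthogonal decomposition; for `≥`, split a minimal cube decomposition
  -- by axes.
  refine le_antisymm (h1.2 (hgroup _ _ h2.1 ?_)) (Nat.ceil_le.2 ?_)
  · have := Nat.le_ceil ((cubeOrthArboricity m T : ℚ) / ((m + 1 : ℕ) : ℚ))
    rw [div_le_iff₀ hpos] at this
    exact_mod_cast this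
  · rw [div_le_iff₀ hpos]
    exact_mod_cast h2.2 (hsplit _ h1.1)
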